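/- For real $\nu\ge-\tfrac12$ let $I_\nu(x)=\sum_{n\ge0}\frac{(x/2)^{2n+\nu}}{n!\,\Gamma(n+\nu+1)}$ $(x>0)$ be the modified Bessel function of the first kind, and let $\Phi_\nu(x)=e^{-x}x^{-\nu}\left[I_\nu(x)+I_{\nu+1}(x)\right]$ for $x>0$. A function $f:(0,\infty)\to\mathbb{R}$ is completely monotonic if it has derivatives of all orders and $(-1)^mf^{(m)}(x)\ge0$ for all $x>0$ and $m\in\{0,1,2,\dots\}$. A function $g:(0,\infty)\to(0,\infty)$ is log-convex if $g(\lambda x+(1-\lambda)y)\le g(x)^\lambda g(y)^{1-\lambda}$, and geometrically concave if $g(x^\lambda y^{1-\lambda})\ge g(x)^\lambda g(y)^{1-\lambda}$, for all $x,y>0$ and $\lambda\in[0,1]$. The following assertions are valid. (a) $\Phi_\nu$ is completely monotonic on $(0,\infty)$ for all $\nu\ge-\tfrac12$. (b) $\Phi_\nu$ is positive, log-convex and geometrically concave on $(0,\infty)$ for all $\nu\ge-\tfrac12$. (c) $\nu\mapsto\Phi_\nu(x)$ is strictly decreasing on $[0,\infty)$ for all $x>0$. (d) $x\mapsto x^{\nu+\frac12}\,\Phi_\nu(x)$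 is increasing on $(0,\infty)$ for all $\nu\ge-\tfrac12$. (e) $x\mapsto\left(x+\tfrac{\nu}{2}\right)^{\nu+\frac12}\Phi_\nu(x)$ is increasing for all $\nu\ge-\tfrac12$, on the set of those $x>0$ for which the power is defined, that is, on $(0,\infty)$ if $\nu\ge0$ or $\nu=-\tfrac12$ (where the exponent is $0$ and the power is $1$), and on $[-\tfrac{\nu}{2},\infty)$ if $-\tfrac12<\nu<0$. (f) $x\mapsto\left(x+\tfrac{\nu}{2}+\tfrac14\right)^{\nu+\frac12}\Phi_\nu(x)$ is increasing on $(0,\infty)$ for all $\nu\ge-\tfrac12$. In (d), (e) and (f) the functions are nondecreasing for all $\nu\ge-\tfrac12$, and strictly increasing if $\nu>-\tfrac12$. (g) For all $\nu>-\tfrac12$ and $x>0$, $$\frac{\left(\nu+\frac12\right)^{\nu+\frac12}}{2^{2\nu+\frac12}\,\Gamma(\nu+1)\left(x+\frac{\nu}{2}+\frac14\right)^{\nu+\frac12}}<\Phi_\nu(x)<\sqrt{\frac{2}{\pi}}\cdot\frac{1}{\left(x+\frac{\nu}{2}+\frac14\right)^{\nu+\frac12}}.$$ -/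

import Mathlib

open Set Real
open scoped Nat ContDiff

noncomputable section

/-- The modified Bessel function of the first kind of real order `ν`, for real argument `x > 0`,
`I_ν(x) = ∑_{n ≥ 0} (x/2)^(2n+ν) / (n! Γ(n+ν+1))`. (`Real.Gamma` is `0` at its poles, so that the
corresponding terms vanish, which is the usual convention `1/Γ = 0` there.) -/
def besselI (ν x : ℝ) : ℝ :=
  ∑' n : ℕ, (x / 2) ^ (2 * (n : ℝ) + ν) / ((n ! : ℝ) * Real.Gamma ((n : ℝ) + ν + 1))

/-- `Φ_ν(x) = e^{-x} x^{-ν} [I_ν(x) + I_{ν+1}(x)]`, for `x > 0`. -/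
def Phi (ν x : ℝ) : ℝ :=
  Real.exp (-x) * x ^ (-ν) * (besselI ν x + besselI (ν + 1) x)

/-- Complete monotonicity on `(0,∞)`: derivatives of all orders exist and alternate in sign. -/
def IsCompletelyMonotonic (f : ℝ → ℝ) : Prop :=
  ContDiffOn ℝ ∞ f (Ioi 0) ∧
    ∀ m : ℕ, ∀ x : ℝ, 0 < x → 0 ≤ (-1 : ℝ) ^ m * iteratedDerivWithin m f (Ioi 0) x

/-- `g` maps `(0,∞)` to `(0,∞)` and is logarithmically convex there. -/
def IsLogConvex (g : ℝ → ℝ) : Prop :=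
  (∀ x : ℝ, 0 < x → 0 < g x) ∧
    ∀ x y l : ℝ, 0 < x → 0 < y → 0 ≤ l → l ≤ 1 →
      g (l * x + (1 - l) * y) ≤ g x ^ l * g y ^ (1 - l)

/-- `h` maps `(0,∞)` to `(0,∞)` and is geometrically (multiplicatively) concave there. -/
def IsGeometricallyConcave (h : ℝ → ℝ) : Prop :=
  (∀ x : ℝ, 0 < x → 0 < h x) ∧
    ∀ x y l : ℝ, 0 < x → 0 < y → 0 ≤ l → l ≤ 1 →
      h x ^ l * h y ^ (1 - l) ≤ h (x ^ l * y ^ (1 - l))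

/-- The points `x > 0` at which the real power `(x + ν/2)^(ν + 1/2)` makes sense (`ν ≥ -1/2`):
the base is nonnegative, or the exponent is zero. For `ν ≥ 0` or `ν = -1/2` this is all of
`(0,∞)`; for `-1/2 < ν < 0` it is `[-ν/2, ∞)`. -/
def powDomain (ν : ℝ) : Set ℝ :=
  {x : ℝ | 0 < x ∧ (0 ≤ x + ν / 2 ∨ ν = -1 / 2)}

end

/-!
Put `a = ν + 1/2` and let `f` be the Laplace transform of the distribution `Beta(a, a + 1)`. For
`ν > -1/2` one has `Φ_ν(x) = f(2 * x) / (2 ^ ν * Γ(ν + 1))` (`Phi_eq_betaLaplace`), while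
`Φ_{-1/2}` is the constant `√(2 / π)` (`Phi_neg_half`). The bridge is Stein's identity
`betaMeasure_stein`: applied to powers of `1 - 2 * s` it gives a recursion for the moments that
the coefficients of the two Bessel series satisfy as well.

Complete monotonicity is immediate from the integral, and log-convexity is the Cauchy–Schwarz
inequality `f' ^ 2 ≤ f * f''` (`betaLaplace_one_sq_le`). The other assertions about the variable `x`
come from Kummer's equation `y f'' + (2a + 1 + y) f' + a f = 0`, which is Stein's identity for
exponentials, and from the barrier principle `pos_of_deriv_pos_of_nonpos`:
* `a f + (a + y) f' > 0` (`betaLaplace_barrier`), so that `(y + a) ^ a * f y` strictly increases.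
  This is the monotonicity with the largest shift `ν/2 + 1/4`; smaller shifts follow by multiplying
  by a power of a nondecreasing ratio. Its values at `0` and at infinity, the latter computed with
  Euler's integral and Legendre's duplication formula, are the two-sided bounds on `Φ_ν`.
* With `g = -f'/f`, the function `y * g y` is nondecreasing (`betaLaplace_riccati_pos`), which is
  geometric concavity.

Monotonicity in `ν ≥ 0` holds for each term of the Bessel series, because `2 ^ s * Γ(s)` is strictly
increasing on `[1, ∞)`: it is log-convex and its logarithmic derivative at `1` is
`log 2 - γ > 0`.
-/

section

open MeasureTheory ProbabilityTheory

/-! ### The beta distribution -/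

lemma measurable_betaPDF (α β : ℝ) : Measurable (betaPDF α β) :=
  (measurable_betaPDFReal α β).ennreal_ofReal

lemma ae_mem_Ioo_betaMeasure (α β : ℝ) : ∀ᵐ s ∂(betaMeasure α β), s ∈ Ioo (0 : ℝ) 1 := by
  rw [betaMeasure, ae_withDensity_iff (measurable_betaPDF α β)]
  refine Filter.Eventually.of_forall fun s hs => ?_
  by_contra h
  apply hs
  simp only [mem_Ioo, not_and_or, not_lt] at h
  rcases h with h | h
  · exact betaPDF_eq_zero_of_nonpos h
  · exact betaPDF_eq_zero_of_one_le h

lemma betaPDF_toReal_smul {α β : ℝ} (hα : 0 < α) (hβ : 0 < β) (g : ℝ → ℝ) :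
    (fun s => (betaPDF α β s).toReal • g s) =
      (Ioo (0 : ℝ) 1).indicator
        (fun s => 1 / beta α β * (s ^ (α - 1) * (1 - s) ^ (β - 1) * g s)) := by
  ext s
  by_cases h : s ∈ Ioo (0 : ℝ) 1
  · rw [indicator_of_mem h, betaPDF, ENNReal.toReal_ofReal (betaPDFReal_pos h.1 h.2 hα hβ).le,
      betaPDFReal, if_pos ⟨h.1, h.2⟩, smul_eq_mul]
    ring
  · rw [indicator_of_notMem h, betaPDF, betaPDFReal, if_neg (by simpa using h)]
    simp

lemma integral_betaMeasure {α β : ℝ} (hα : 0 < α) (hβ : 0 < β) (g : ℝ → ℝ) :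
    ∫ s, g s ∂(betaMeasure α β) =
      1 / beta α β * ∫ s in Ioo (0 : ℝ) 1, s ^ (α - 1) * (1 - s) ^ (β - 1) * g s := by
  rw [betaMeasure, integral_withDensity_eq_integral_toReal_smul
    (measurable_betaPDF α β)
    (Filter.Eventually.of_forall fun s => ENNReal.ofReal_lt_top),
    betaPDF_toReal_smul hα hβ, integral_indicator measurableSet_Ioo, integral_const_mul]

lemma integrable_betaMeasure_iff {α β : ℝ} (hα : 0 < α) (hβ : 0 < β) (g : ℝ → ℝ) :
    Integrable g (betaMeasure α β) ↔
      IntegrableOn (fun s => s ^ (α - 1) * (1 - s) ^ (β - 1) * g s) (Ioo 0 1) := by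
  rw [betaMeasure, integrable_withDensity_iff_integrable_smul'
    (measurable_betaPDF α β)
    (Filter.Eventually.of_forall fun s => ENNReal.ofReal_lt_top),
    betaPDF_toReal_smul hα hβ, integrable_indicator_iff measurableSet_Ioo, IntegrableOn,
    IntegrableOn,
    integrable_const_mul_iff (isUnit_iff_ne_zero.2 (one_div_pos.2 (beta_pos hα hβ)).ne')]

lemma integrable_betaMeasure_of_continuous {α β : ℝ} (hα : 0 < α) (hβ : 0 < β) {g : ℝ → ℝ}
    (hg : Continuous g) : Integrable g (betaMeasure α β) := by
  have := isProbabilityMeasureBeta hα hβ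
  obtain ⟨C, hC⟩ := (isCompact_Icc (a := (0 : ℝ)) (b := 1)).exists_bound_of_continuousOn
    hg.continuousOn
  refine Integrable.of_bound hg.aestronglyMeasurable C ?_
  filter_upwards [ae_mem_Ioo_betaMeasure α β] with s hs using hC s (Ioo_subset_Icc_self hs)

/-- Stein's identity for the distribution `Beta(a, a + 1)`: integration of the derivative of
`s ^ a * (1 - s) ^ (a + 1) * u s`, which vanishes at both endpoints. -/
lemma betaMeasure_stein {a : ℝ} (ha : 0 < a) {u u' : ℝ → ℝ} (hu : ∀ s, HasDerivAt u (u' s) s)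
    (hu' : Continuous u') :
    ∫ s, ((a - (2 * a + 1) * s) * u s + s * (1 - s) * u' s) ∂(betaMeasure a (a + 1)) = 0 := by
  have huc : Continuous u := continuous_iff_continuousAt.2 fun s => (hu s).continuousAt
  have hint := (integrable_betaMeasure_iff ha (by linarith : 0 < a + 1) _).1
    (integrable_betaMeasure_of_continuous ha (by linarith : 0 < a + 1)
      (by fun_prop : Continuous fun s => (a - (2 * a + 1) * s) * u s + s * (1 - s) * u' s))
  rw [integral_betaMeasure ha (by linarith)]
  rw [← integral_Ioc_eq_integral_Ioo, ← intervalIntegral.integral_of_le zero_le_one]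
  have key := intervalIntegral.integral_eq_sub_of_hasDerivAt_of_le (a := (0 : ℝ)) (b := 1)
    zero_le_one (f := fun s => s ^ a * (1 - s) ^ (a + 1) * u s)
    (f' := fun s => s ^ (a - 1) * (1 - s) ^ (a + 1 - 1) *
      ((a - (2 * a + 1) * s) * u s + s * (1 - s) * u' s)) ?_ ?_ ?_
  · rw [key]
    simp [Real.zero_rpow ha.ne', Real.zero_rpow (by linarith : a + 1 ≠ 0)]
  · refine Continuous.continuousOn ?_
    have h1 : Continuous fun s : ℝ => s ^ a := Real.continuous_rpow_const ha.le
    have h2 : Continuous fun s : ℝ => (1 - s) ^ (a + 1) :=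
      (Real.continuous_rpow_const (by linarith : 0 ≤ a + 1)).comp (continuous_const.sub continuous_id)
    exact (h1.mul h2).mul huc
  · intro s hs
    have hs1 : 0 < 1 - s := by linarith [hs.2]
    have h1 : HasDerivAt (fun s : ℝ => s ^ a) (a * s ^ (a - 1)) s :=
      Real.hasDerivAt_rpow_const (Or.inl hs.1.ne')
    have h2 : HasDerivAt (fun s : ℝ => (1 - s) ^ (a + 1)) (-((a + 1) * (1 - s) ^ (a + 1 - 1))) s := by
      have := ((hasDerivAt_id s).const_sub 1).rpow_const (p := a + 1) (Or.inl hs1.ne')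
      simp only [id] at this
      exact this.congr_deriv (by ring)
    refine ((h1.mul h2).mul (hu s)).congr_deriv ?_
    have e1 : s ^ a = s * s ^ (a - 1) := by
      rw [Real.rpow_sub_one hs.1.ne']; field_simp [hs.1.ne']
    have e2 : (1 - s) ^ (a + 1) = (1 - s) * (1 - s) ^ (a + 1 - 1) := by
      rw [Real.rpow_sub_one hs1.ne']; field_simp
    simp only [Pi.mul_apply]
    rw [e2, e1]
    ring
  · rw [intervalIntegrable_iff_integrableOn_Ioo_of_le zero_le_one]
    exact hint

/-! ### A barrier principle -/

/-- A barrier principle: a function that is positive at `0`, and increasing wherever it is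
nonpositive, stays positive. -/
lemma pos_of_deriv_pos_of_nonpos {p p' : ℝ → ℝ} (hc : ContinuousOn p (Ici 0)) (h0 : 0 < p 0)
    (hp : ∀ x, 0 < x → HasDerivAt p (p' x) x) (hpos : ∀ x, 0 < x → p x ≤ 0 → 0 < p' x)
    {x : ℝ} (hx : 0 < x) : 0 < p x := by
  by_contra! hneg
  obtain ⟨m, hm, hmin⟩ := (isCompact_Icc (a := (0 : ℝ)) (b := x)).exists_isMinOn
    (nonempty_Icc.2 hx.le) (hc.mono Icc_subset_Ici_self)
  have hmx : p m ≤ p x := hmin (right_mem_Icc.2 hx.le)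
  have hm0 : 0 < m := hm.1.lt_of_ne fun h => by rw [← h] at hmx; linarith
  -- A positive derivative at the minimum would give smaller values just to its left.
  have hslope := (hp m hm0).tendsto_slope
  have hev : ∀ᶠ z in nhdsWithin m (Iio m), 0 < slope p m z :=
    (hslope.eventually (lt_mem_nhds (hpos m hm0 (hmx.trans hneg)))).filter_mono
      (nhdsWithin_mono _ fun z hz => (ne_of_lt hz : z ≠ m))
  obtain ⟨z, hz, hzI⟩ := (hev.and (Ioo_mem_nhdsLT hm0)).exists
  have hle : p m ≤ p z := hmin ⟨hzI.1.le, hzI.2.le.trans hm.2⟩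
  rw [slope_def_field] at hz
  have := (div_pos_iff.1 hz)
  rcases this with h | h <;> linarith [hzI.2]

/-! ### Laplace transform of the beta distribution and Kummer's equation -/

/-- The integral of `(-s) ^ k * exp (-y * s)` against the distribution `Beta(a, a + 1)`: the `k`-th
derivative at `y` of its Laplace transform, for every real `y`. -/
noncomputable def betaLaplace (a : ℝ) (k : ℕ) (y : ℝ) : ℝ :=
  ∫ s, (-s) ^ k * exp (y * -s) ∂(betaMeasure a (a + 1))

lemma hasDerivAt_betaLaplace {a : ℝ} (ha : 0 < a) (k : ℕ) (y : ℝ) :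
    HasDerivAt (betaLaplace a k) (betaLaplace a (k + 1) y) y := by
  refine hasDerivAt_integral_pow_mul_exp_real (X := fun s : ℝ => -s)
    (μ := betaMeasure a (a + 1)) ?_ k
  have : integrableExpSet (fun s : ℝ => -s) (betaMeasure a (a + 1)) = univ :=
    eq_univ_of_forall fun t =>
      integrable_betaMeasure_of_continuous ha (by linarith) (by fun_prop)
  simp [this]

lemma continuous_betaLaplace {a : ℝ} (ha : 0 < a) (k : ℕ) : Continuous (betaLaplace a k) :=
  continuous_iff_continuousAt.2 fun y => (hasDerivAt_betaLaplace ha k y).continuousAt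

lemma iteratedDeriv_betaLaplace {a : ℝ} (ha : 0 < a) (m : ℕ) :
    iteratedDeriv m (betaLaplace a 0) = betaLaplace a m := by
  induction m with
  | zero => simp
  | succ m ih =>
    rw [iteratedDeriv_succ, ih]
    exact funext fun y => (hasDerivAt_betaLaplace ha m y).deriv

lemma contDiff_betaLaplace {a : ℝ} (ha : 0 < a) : ContDiff ℝ ∞ (betaLaplace a 0) :=
  contDiff_of_differentiable_iteratedDeriv fun m _ => by
    rw [iteratedDeriv_betaLaplace ha]
    exact fun y => (hasDerivAt_betaLaplace ha m y).differentiableAt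

lemma neg_one_pow_mul_betaLaplace_nonneg (a : ℝ) (k : ℕ) (y : ℝ) :
    0 ≤ (-1) ^ k * betaLaplace a k y := by
  rw [betaLaplace, ← integral_const_mul]
  refine integral_nonneg_of_ae ?_
  filter_upwards [ae_mem_Ioo_betaMeasure a (a + 1)] with s hs
  rw [← mul_assoc, ← mul_pow]
  have := hs.1
  simp only [Pi.zero_apply, neg_mul_neg, one_mul]
  positivity

lemma betaLaplace_one_nonpos (a y : ℝ) : betaLaplace a 1 y ≤ 0 := by
  have := neg_one_pow_mul_betaLaplace_nonneg a 1 y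
  linarith

lemma betaLaplace_zero_pos {a : ℝ} (ha : 0 < a) (y : ℝ) : 0 < betaLaplace a 0 y := by
  have := isProbabilityMeasureBeta ha (by linarith : 0 < a + 1)
  have := mgf_pos (μ := betaMeasure a (a + 1)) (X := fun s : ℝ => -s) (t := y)
    (integrable_betaMeasure_of_continuous ha (by linarith) (by fun_prop))
  simpa [mgf, betaLaplace] using this

lemma betaLaplace_zero_zero {a : ℝ} (ha : 0 < a) : betaLaplace a 0 0 = 1 := by
  have := isProbabilityMeasureBeta ha (by linarith : 0 < a + 1)
  simp [betaLaplace]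

/-- Kummer's differential equation. -/
lemma betaLaplace_ode {a : ℝ} (ha : 0 < a) (y : ℝ) :
    y * betaLaplace a 2 y + (2 * a + 1 + y) * betaLaplace a 1 y + a * betaLaplace a 0 y = 0 := by
  have key := betaMeasure_stein ha (u := fun s => exp (y * -s)) (u' := fun s => -y * exp (y * -s))
    (fun s => by
      have := (((hasDerivAt_id s).neg).const_mul y).exp
      exact this.congr_deriv (by simp only [id, Pi.neg_apply]; ring)) (by fun_prop)
  have hi : ∀ k : ℕ, Integrable (fun s : ℝ => (-s) ^ k * exp (y * -s)) (betaMeasure a (a + 1)) :=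
    fun k => integrable_betaMeasure_of_continuous ha (by linarith) (by fun_prop)
  have h21 : Integrable (fun s : ℝ => y * ((-s) ^ 2 * exp (y * -s))
      + (2 * a + 1 + y) * ((-s) ^ 1 * exp (y * -s))) (betaMeasure a (a + 1)) :=
    ((hi 2).const_mul _).add ((hi 1).const_mul _)
  simp only [betaLaplace]
  rw [← integral_const_mul, ← integral_const_mul, ← integral_const_mul,
    ← integral_add ((hi 2).const_mul _) ((hi 1).const_mul _),
    ← integral_add h21 ((hi 0).const_mul _), ← key]
  congr 1
  ext s
  ring

lemma betaLaplace_one_zero {a : ℝ} (ha : 0 < a) : betaLaplace a 1 0 = -a / (2 * a + 1) := by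
  have := betaLaplace_ode ha 0
  rw [betaLaplace_zero_zero ha] at this
  rw [eq_div_iff (by positivity)]
  linarith

lemma betaLaplace_one_sq_le {a : ℝ} (ha : 0 < a) (y : ℝ) :
    betaLaplace a 1 y ^ 2 ≤ betaLaplace a 0 y * betaLaplace a 2 y := by
  have hi : ∀ k : ℕ, Integrable (fun s : ℝ => (-s) ^ k * exp (y * -s)) (betaMeasure a (a + 1)) :=
    fun k => integrable_betaMeasure_of_continuous ha (by linarith) (by fun_prop)
  -- the variance of `-s` under the exponentially tilted measure is nonnegative
  have key : ∀ m : ℝ, 0 ≤ betaLaplace a 2 y + (-2 * m) * betaLaplace a 1 y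
      + m ^ 2 * betaLaplace a 0 y := by
    intro m
    have h21 : Integrable (fun s : ℝ => (-s) ^ 2 * exp (y * -s)
        + -2 * m * ((-s) ^ 1 * exp (y * -s))) (betaMeasure a (a + 1)) :=
      (hi 2).add ((hi 1).const_mul _)
    simp only [betaLaplace]
    rw [← integral_const_mul, ← integral_const_mul, ← integral_add (hi 2) ((hi 1).const_mul _),
      ← integral_add h21 ((hi 0).const_mul _)]
    refine integral_nonneg fun s => ?_
    have : 0 ≤ (-s - m) ^ 2 * exp (y * -s) := by positivity
    simp only [Pi.zero_apply]
    linarith [this]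
  have h0 := betaLaplace_zero_pos ha y
  have := mul_nonneg h0.le (key (betaLaplace a 1 y / betaLaplace a 0 y))
  field_simp at this
  linarith

/-- The sharp bound `-f'/f ≤ a / (a + y)` for the Laplace transform `f` of `Beta(a, a + 1)`. -/
lemma betaLaplace_barrier {a : ℝ} (ha : 0 < a) {y : ℝ} (hy : 0 < y) :
    0 < a * betaLaplace a 0 y + (a + y) * betaLaplace a 1 y := by
  refine pos_of_deriv_pos_of_nonpos
    (p := fun y => a * betaLaplace a 0 y + (a + y) * betaLaplace a 1 y)
    (p' := fun y => a * betaLaplace a 1 y + (1 * betaLaplace a 1 y + (a + y) * betaLaplace a 2 y))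
    ?_ ?_ ?_ ?_ hy
  · have := continuous_betaLaplace ha 0
    have := continuous_betaLaplace ha 1
    exact Continuous.continuousOn (by fun_prop)
  · simp only [betaLaplace_zero_zero ha, betaLaplace_one_zero ha, add_zero]
    have : a * 1 + a * (-a / (2 * a + 1)) = a * (a + 1) / (2 * a + 1) := by
      field_simp
      ring
    rw [this]
    positivity
  · intro x _
    exact ((hasDerivAt_betaLaplace ha 0 x).const_mul a).add
      (((hasDerivAt_id x).const_add a).mul (hasDerivAt_betaLaplace ha 1 x))
  · intro x hx hneg
    have ode := betaLaplace_ode ha x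
    have h0 := betaLaplace_zero_pos ha x
    set f0 := betaLaplace a 0 x
    set f1 := betaLaplace a 1 x
    set f2 := betaLaplace a 2 x
    refine pos_of_mul_pos_right (a := x) ?_ hx.le
    -- the differential equation eliminates `f2`
    have e : x * (a * f1 + (1 * f1 + (a + x) * f2))
        = -(x ^ 2 + 2 * a * x + 2 * a ^ 2 + a) * f1 - a * (a + x) * f0 := by
      linear_combination (a + x) * ode
    rw [e]
    refine pos_of_mul_pos_right (a := a + x) ?_ (by positivity)
    have h1 : 0 ≤ (x ^ 2 + 2 * a * x + 2 * a ^ 2 + a) * -(a * f0 + (a + x) * f1) :=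
      mul_nonneg (by positivity) (by linarith)
    have h2 : 0 < a * f0 * (a ^ 2 + a) := by positivity
    nlinarith [h1, h2]

/-! ### The logarithmic derivative -/

lemma hasDerivAt_neg_logDeriv_betaLaplace {a : ℝ} (ha : 0 < a) (y : ℝ) :
    HasDerivAt (fun y => -betaLaplace a 1 y / betaLaplace a 0 y)
      (-betaLaplace a 2 y / betaLaplace a 0 y + (-betaLaplace a 1 y / betaLaplace a 0 y) ^ 2) y := by
  have h0 := (betaLaplace_zero_pos ha y).ne'
  refine ((hasDerivAt_betaLaplace ha 1 y).neg.div (hasDerivAt_betaLaplace ha 0 y) h0).congr_deriv ?_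
  simp only [Pi.neg_apply]
  field_simp
  ring

/-- With `g = -f'/f`, the quantity below is `(y * g)'` by Kummer's equation. -/
lemma betaLaplace_riccati_pos {a : ℝ} (ha : 0 < a) {y : ℝ} (hy : 0 < y) :
    0 < a - (2 * a + y) * (-betaLaplace a 1 y / betaLaplace a 0 y)
      + y * (-betaLaplace a 1 y / betaLaplace a 0 y) ^ 2 := by
  set g : ℝ → ℝ := fun y => -betaLaplace a 1 y / betaLaplace a 0 y with hg
  set g' : ℝ → ℝ := fun y => -betaLaplace a 2 y / betaLaplace a 0 y + g y ^ 2 with hg'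
  have hd : ∀ x, HasDerivAt g (g' x) x := hasDerivAt_neg_logDeriv_betaLaplace ha
  refine pos_of_deriv_pos_of_nonpos (p := fun y => a - (2 * a + y) * g y + y * g y ^ 2)
    (p' := fun y => -(1 * g y + (2 * a + y) * g' y) +
      (1 * g y ^ 2 + y * (2 * g y * g' y))) ?_ ?_ ?_ ?_ hy
  · have : Continuous g := continuous_iff_continuousAt.2 fun y => (hd y).continuousAt
    exact Continuous.continuousOn (by fun_prop)
  · simp only [hg, betaLaplace_zero_zero ha, betaLaplace_one_zero ha, add_zero]
    have : a - 2 * a * (-(-a / (2 * a + 1)) / 1) + 0 * (-(-a / (2 * a + 1)) / 1) ^ 2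
        = a / (2 * a + 1) := by
      field_simp
      ring
    rw [this]
    positivity
  · intro x _
    have h1 := (((hasDerivAt_id x).const_add (2 * a)).mul (hd x)).const_sub a
    have h2 := (hasDerivAt_id x).mul ((hd x).pow 2)
    refine (h1.add h2).congr_deriv ?_
    simp
  · intro x hx hneg
    have h0 := betaLaplace_zero_pos ha x
    have hric : x * g' x = -(2 * a + 1 + x) * g x + a + x * g x ^ 2 := by
      have ode := betaLaplace_ode ha x
      simp only [hg', hg]
      field_simp
      linear_combination -betaLaplace a 0 x * ode
    have hb : (a + x) * g x < a := by
      have := betaLaplace_barrier ha hx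
      simp only [hg]
      rw [mul_div_assoc', div_lt_iff₀ h0]
      linarith
    have hg0 : 0 ≤ g x := div_nonneg (by linarith [betaLaplace_one_nonpos a x]) h0.le
    have hgpos : 0 < g x := hg0.lt_of_ne fun h => by
      simp only [← h] at hneg
      linarith
    have hw : x * g x < a := by nlinarith
    -- substituting the Riccati equation `hric` leaves a positive term and a multiple of `-p x`
    refine pos_of_mul_pos_right (a := x) ?_ hx.le
    have e : x * (-(1 * g x + (2 * a + x) * g' x) + (1 * g x ^ 2 + x * (2 * g x * g' x)))
        = g x * (2 * a - x * g x)
          + (2 * a + x - 2 * (x * g x)) * -(a - (2 * a + x) * g x + x * g x ^ 2) := by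
      linear_combination (2 * x * g x - (2 * a + x)) * hric
    rw [e]
    have h1 : 0 < g x * (2 * a - x * g x) := mul_pos hgpos (by linarith)
    have h2 : 0 ≤ (2 * a + x - 2 * (x * g x)) * -(a - (2 * a + x) * g x + x * g x ^ 2) :=
      mul_nonneg (by linarith) (by linarith)
    linarith

lemma monotoneOn_mul_neg_logDeriv_betaLaplace {a : ℝ} (ha : 0 < a) :
    MonotoneOn (fun y => y * (-betaLaplace a 1 y / betaLaplace a 0 y)) (Ioi 0) := by
  have hd := fun y => (hasDerivAt_id y).mul (hasDerivAt_neg_logDeriv_betaLaplace ha y)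
  refine monotoneOn_of_deriv_nonneg (convex_Ioi 0) (fun y _ => (hd y).continuousAt.continuousWithinAt)
    (fun y _ => (hd y).differentiableAt.differentiableWithinAt) fun y hy => ?_
  rw [interior_Ioi] at hy
  refine le_of_le_of_eq (betaLaplace_riccati_pos ha hy).le (Eq.trans ?_ (hd y).deriv.symm)
  have h0 := (betaLaplace_zero_pos ha y).ne'
  have ode := betaLaplace_ode ha y
  simp only [id]
  field_simp
  linear_combination betaLaplace a 0 y * ode

lemma antitone_neg_logDeriv_betaLaplace {a : ℝ} (ha : 0 < a) :
    Antitone (fun y => -betaLaplace a 1 y / betaLaplace a 0 y) := by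
  refine antitone_of_deriv_nonpos
    (fun y => (hasDerivAt_neg_logDeriv_betaLaplace ha y).differentiableAt) fun y => ?_
  rw [(hasDerivAt_neg_logDeriv_betaLaplace ha y).deriv]
  have h0 := betaLaplace_zero_pos ha y
  have := betaLaplace_one_sq_le ha y
  rw [div_pow, neg_sq, div_add_div _ _ h0.ne' (by positivity)]
  refine div_nonpos_of_nonpos_of_nonneg ?_ (by positivity)
  nlinarith

lemma convexOn_log_betaLaplace {a : ℝ} (ha : 0 < a) :
    ConvexOn ℝ univ (fun y => log (betaLaplace a 0 y)) := by
  have hd := fun y => (hasDerivAt_betaLaplace ha 0 y).log (betaLaplace_zero_pos ha y).ne'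
  refine MonotoneOn.convexOn_of_deriv convex_univ (fun y _ => (hd y).continuousAt.continuousWithinAt)
    (fun y _ => (hd y).differentiableAt.differentiableWithinAt) fun y _ z _ hyz => ?_
  rw [(hd y).deriv, (hd z).deriv]
  have := antitone_neg_logDeriv_betaLaplace ha hyz
  simp only [neg_div] at this
  linarith

/-- Geometric concavity in logarithmic coordinates. -/
lemma concaveOn_log_betaLaplace_exp {a : ℝ} (ha : 0 < a) :
    ConcaveOn ℝ univ (fun t => log (betaLaplace a 0 (exp t))) := by
  have hd := fun t => ((hasDerivAt_betaLaplace ha 0 (exp t)).comp t (Real.hasDerivAt_exp t)).log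
    (betaLaplace_zero_pos ha (exp t)).ne'
  refine AntitoneOn.concaveOn_of_deriv convex_univ
    (fun y _ => (hd y).continuousAt.continuousWithinAt)
    (fun y _ => (hd y).differentiableAt.differentiableWithinAt) fun y _ z _ hyz => ?_
  have e1 := (hd y).deriv
  have e2 := (hd z).deriv
  simp only [Function.comp_def] at e1 e2
  rw [e1, e2]
  have := monotoneOn_mul_neg_logDeriv_betaLaplace ha (exp_pos y) (exp_pos z) (exp_le_exp.2 hyz)
  simp only [neg_div, mul_neg, ← mul_div_assoc] at this
  simp only [mul_comm (betaLaplace a (0 + 1) _)]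
  simpa using this

lemma strictMonoOn_rpow_mul_betaLaplace {a : ℝ} (ha : 0 < a) :
    StrictMonoOn (fun y => (y + a) ^ a * betaLaplace a 0 y) (Ici 0) := by
  have hd : ∀ y ∈ Ici (0 : ℝ), HasDerivAt (fun y => (y + a) ^ a * betaLaplace a 0 y)
      ((y + a) ^ (a - 1) * (a * betaLaplace a 0 y + (a + y) * betaLaplace a 1 y)) y := by
    intro y hy
    have hya : 0 < y + a := add_pos_of_nonneg_of_pos hy ha
    have h1 := ((hasDerivAt_id y).add_const a).rpow_const (p := a) (Or.inl hya.ne')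
    refine (h1.mul (hasDerivAt_betaLaplace ha 0 y)).congr_deriv ?_
    have : (y + a) ^ a = (y + a) * (y + a) ^ (a - 1) := by
      rw [Real.rpow_sub_one hya.ne']; field_simp
    simp only [id]
    rw [this]
    ring
  refine strictMonoOn_of_deriv_pos (convex_Ici 0)
    (fun y hy => (hd y hy).continuousAt.continuousWithinAt) fun y hy => ?_
  rw [interior_Ici] at hy
  rw [(hd y (mem_Ici.2 (le_of_lt hy))).deriv]
  have hya : 0 < y + a := add_pos hy ha
  exact mul_pos (by positivity) (betaLaplace_barrier ha hy)

/-- Euler's integral over `(0, ∞)` dominates, since `(1 - s) ^ a ≤ 1`. -/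
lemma betaLaplace_zero_le {a : ℝ} (ha : 0 < a) {y : ℝ} (hy : 0 < y) :
    betaLaplace a 0 y ≤ 1 / beta a (a + 1) * ((1 / y) ^ a * Gamma a) := by
  have hb := beta_pos ha (by linarith : 0 < a + 1)
  rw [← integral_rpow_mul_exp_neg_mul_Ioi ha hy, betaLaplace,
    integral_betaMeasure ha (by linarith)]
  have hI : IntegrableOn (fun t : ℝ => t ^ (a - 1) * exp (-(y * t))) (Ioi 0) := by
    have := integrableOn_rpow_mul_exp_neg_mul_rpow (s := a - 1) (p := 1) (by linarith) one_pos hy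
    simpa [neg_mul] using this
  refine mul_le_mul_of_nonneg_left ?_ (by positivity)
  calc _ ≤ ∫ t in Ioo (0 : ℝ) 1, t ^ (a - 1) * exp (-(y * t)) := by
        refine setIntegral_mono_on ?_ (hI.mono_set Ioo_subset_Ioi_self) measurableSet_Ioo ?_
        · exact (integrable_betaMeasure_iff ha (by linarith : 0 < a + 1) _).1
            (integrable_betaMeasure_of_continuous ha (by linarith) (by fun_prop))
        · intro s hs
          have h1 : (1 - s) ^ (a + 1 - 1) ≤ 1 :=
            rpow_le_one (by linarith [hs.2]) (by linarith [hs.1]) (by linarith)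
          have h2 : 0 ≤ s ^ (a - 1) := rpow_nonneg hs.1.le _
          rw [pow_zero, one_mul, mul_neg]
          exact mul_le_mul_of_nonneg_right (mul_le_of_le_one_right h2 h1) (exp_pos _).le
    _ ≤ _ := by
        refine setIntegral_mono_set hI ?_ (Ioo_subset_Ioi_self.eventuallyLE)
        refine (ae_restrict_iff' measurableSet_Ioi).2 (Filter.Eventually.of_forall fun t ht => ?_)
        have : (0 : ℝ) < t := ht
        simp only [Pi.zero_apply]
        positivity

/-- The right-hand side is the limit of the strictly increasing left-hand side at infinity. -/
lemma rpow_mul_betaLaplace_lt {a : ℝ} (ha : 0 < a) {y : ℝ} (hy : 0 < y) :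
    (y + a) ^ a * betaLaplace a 0 y < 1 / beta a (a + 1) * Gamma a := by
  have hmono := strictMonoOn_rpow_mul_betaLaplace ha
  have hlim : Filter.Tendsto (fun z : ℝ => (1 + a / z) ^ a * (1 / beta a (a + 1) * Gamma a))
      Filter.atTop (nhds ((1 + 0) ^ a * (1 / beta a (a + 1) * Gamma a))) := by
    refine Filter.Tendsto.mul_const _ ?_
    exact ((tendsto_const_nhds.div_atTop Filter.tendsto_id).const_add 1).rpow_const
      (Or.inl (by norm_num))
  refine (hmono (mem_Ici.2 hy.le) (mem_Ici.2 (by linarith)) (lt_add_one y)).trans_le ?_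
  rw [add_zero, one_rpow, one_mul] at hlim
  refine ge_of_tendsto hlim ?_
  filter_upwards [Filter.eventually_ge_atTop (y + 1)] with z hz
  have hz0 : 0 < z := by linarith
  refine (hmono.monotoneOn (mem_Ici.2 (by linarith)) (mem_Ici.2 hz0.le) hz).trans ?_
  have := mul_le_mul_of_nonneg_left (betaLaplace_zero_le ha hz0)
    (by positivity : 0 ≤ (z + a) ^ a)
  refine this.trans_eq ?_
  rw [show 1 + a / z = (z + a) * (1 / z) by field_simp,
    mul_rpow (by positivity) (by positivity)]
  ring

/-! ### Bessel series -/

lemma Gamma_mul_half_pow_le {ν : ℝ} (hν : -1 / 2 ≤ ν) (n : ℕ) :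
    Gamma (ν + 1) * (1 / 2) ^ n ≤ Gamma (n + ν + 1) := by
  induction n with
  | zero => simp
  | succ n ih =>
    have hn : (1 : ℝ) / 2 ≤ n + ν + 1 := by
      have : (0 : ℝ) ≤ n := n.cast_nonneg
      linarith
    have e : Gamma (((n + 1 : ℕ) : ℝ) + ν + 1) = (n + ν + 1) * Gamma (n + ν + 1) := by
      rw [← Gamma_add_one (by linarith)]
      congr 1
      push_cast
      ring
    have hG : 0 < Gamma (n + ν + 1) := Gamma_pos_of_pos (by linarith)
    rw [e, pow_succ]
    nlinarith

lemma summable_besselI {ν : ℝ} (hν : -1 / 2 ≤ ν) {x : ℝ} (hx : 0 < x) :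
    Summable fun n : ℕ => (x / 2) ^ (2 * (n : ℝ) + ν) / ((n ! : ℝ) * Gamma ((n : ℝ) + ν + 1)) := by
  have hG : 0 < Gamma (ν + 1) := Gamma_pos_of_pos (by linarith)
  refine Summable.of_nonneg_of_le (fun n => ?_) (fun n => ?_)
    ((Real.summable_pow_div_factorial (2 * (x / 2) ^ 2)).mul_left ((x / 2) ^ ν / Gamma (ν + 1)))
  · have : 0 < Gamma ((n : ℝ) + ν + 1) :=
      Gamma_pos_of_pos (by have : (0 : ℝ) ≤ n := n.cast_nonneg
                           linarith)
    positivity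
  · have e : (x / 2) ^ (2 * (n : ℝ) + ν) = (x / 2) ^ ν * ((x / 2) ^ 2) ^ n := by
      rw [rpow_add (by positivity), mul_comm, ← pow_mul, ← rpow_natCast]
      push_cast
      rfl
    have h2 : (x / 2) ^ ν / Gamma (ν + 1) * ((2 * (x / 2) ^ 2) ^ n / (n ! : ℝ))
        = (x / 2) ^ ν * ((x / 2) ^ 2) ^ n / ((n ! : ℝ) * (Gamma (ν + 1) * (1 / 2) ^ n)) := by
      rw [mul_pow, div_pow 1 2 n, one_pow]
      field_simp
    rw [h2, e]
    have := Gamma_mul_half_pow_le hν n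
    gcongr

lemma hasSum_rpow_neg_mul_besselI {ν : ℝ} (hν : -1 / 2 ≤ ν) {x : ℝ} (hx : 0 < x) :
    HasSum (fun n : ℕ => (x / 2) ^ (2 * n) / ((n ! : ℝ) * (2 ^ ν * Gamma (n + ν + 1))))
      (x ^ (-ν) * besselI ν x) := by
  refine HasSum.congr_fun ((summable_besselI hν hx).hasSum.mul_left (x ^ (-ν))) fun n => ?_
  have h1 : (x / 2) ^ (2 * (n : ℝ)) = (x / 2) ^ (2 * n) := by
    rw [← rpow_natCast]
    push_cast
    rfl
  have : (0 : ℝ) < x ^ ν := by positivity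
  rw [rpow_add (by positivity), h1, div_rpow hx.le zero_le_two, rpow_neg hx.le]
  field_simp

lemma hasSum_rpow_neg_mul_besselI_add_one {ν : ℝ} (hν : -1 / 2 ≤ ν) {x : ℝ} (hx : 0 < x) :
    HasSum (fun n : ℕ => (x / 2) ^ (2 * n + 1) / ((n ! : ℝ) * (2 ^ ν * Gamma (n + ν + 2))))
      (x ^ (-ν) * besselI (ν + 1) x) := by
  have e : x ^ (-ν) * besselI (ν + 1) x = x * (x ^ (-(ν + 1)) * besselI (ν + 1) x) := by
    rw [neg_add, ← sub_eq_add_neg, rpow_sub_one hx.ne']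
    field_simp
  rw [e]
  refine HasSum.congr_fun
    ((hasSum_rpow_neg_mul_besselI (ν := ν + 1) (by linarith) hx).mul_left x) fun n => ?_
  rw [show (n : ℝ) + (ν + 1) + 1 = n + ν + 2 by ring, rpow_add_one two_ne_zero, pow_succ]
  field_simp

/-- The three-term recursion satisfied by the moments of `1 - 2 * s` under `Beta(a, a + 1)`
splits into two-term recursions, so that their exponential generating function is the sum of two
Bessel series: its even part gives `I_ν` and its odd part `I_{ν+1}`, where `ν = a - 1/2`. -/
lemma hasSum_of_moment_recursion {ν : ℝ} (hν : -1 / 2 ≤ ν) {x : ℝ} (hx : 0 < x) {A : ℕ → ℝ}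
    (h0 : A 0 = 1) (h1 : (2 * ν + 2) * A 1 = A 0)
    (hA : ∀ k : ℕ, (2 * ν + 3 + k) * A (k + 2) = A (k + 1) + (k + 1) * A k) :
    HasSum (fun k : ℕ => A k * (x ^ k / (k ! : ℝ)))
      (2 ^ ν * Gamma (ν + 1) * (x ^ (-ν) * (besselI ν x + besselI (ν + 1) x))) := by
  have hn : ∀ n : ℕ, (0 : ℝ) ≤ n := fun n => n.cast_nonneg
  have hodd : ∀ n : ℕ, (2 * n + 2 * ν + 2) * A (2 * n + 1) = (2 * n + 1) * A (2 * n) ∧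
      A (2 * n + 2) = A (2 * n + 1) := by
    have step : ∀ n : ℕ, (2 * n + 2 * ν + 2) * A (2 * n + 1) = (2 * n + 1) * A (2 * n) →
        A (2 * n + 2) = A (2 * n + 1) := by
      intro n h
      have := hA (2 * n)
      push_cast at this
      have hne : 2 * ν + 3 + 2 * (n : ℝ) ≠ 0 := by linarith [hn n]
      refine mul_left_cancel₀ hne ?_
      linarith
    intro n
    induction n with
    | zero =>
      have : (2 * (0 : ℕ) + 2 * ν + 2) * A (2 * 0 + 1) = (2 * (0 : ℕ) + 1) * A (2 * 0) := by
        simpa using h1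
      exact ⟨this, step 0 this⟩
    | succ n ih =>
      have h3 := hA (2 * n + 1)
      have : (2 * (n + 1 : ℕ) + 2 * ν + 2) * A (2 * (n + 1) + 1)
          = (2 * (n + 1 : ℕ) + 1) * A (2 * (n + 1)) := by
        push_cast at h3 ⊢
        rw [show 2 * (n + 1) + 1 = 2 * n + 1 + 2 by ring, show 2 * (n + 1) = 2 * n + 2 by ring]
        rw [show 2 * n + 1 + 1 = 2 * n + 2 by ring] at h3
        rw [← ih.2] at h3
        linarith
      exact ⟨this, step _ this⟩
  have hG : ∀ n : ℕ, 0 < Gamma (n + ν + 1) := fun n => Gamma_pos_of_pos (by linarith [hn n])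
  have hGs : ∀ n : ℕ, Gamma (n + ν + 2) = (n + ν + 1) * Gamma (n + ν + 1) := fun n => by
    rw [← Gamma_add_one (by linarith [hn n])]
    congr 1
    ring
  have hodd' : ∀ n : ℕ, A (2 * n + 1) = (2 * n + 1) * A (2 * n) / (2 * (n + ν + 1)) := fun n => by
    rw [eq_div_iff (by linarith [hn n])]
    linarith [(hodd n).1]
  have heven : ∀ n : ℕ, A (2 * n) =
      Gamma (ν + 1) * ((2 * n)! : ℝ) / (4 ^ n * (n ! : ℝ) * Gamma (n + ν + 1)) := by
    intro n
    induction n with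
    | zero =>
      have := (hG 0).ne'
      simp only [CharP.cast_eq_zero, zero_add] at this
      simp [h0, this]
    | succ n ih =>
      rw [show 2 * (n + 1) = 2 * n + 2 by ring, (hodd n).2, hodd', ih]
      rw [show ((n + 1 : ℕ) : ℝ) + ν + 1 = n + ν + 2 by push_cast; ring, hGs,
        Nat.factorial_succ (2 * n + 1), Nat.factorial_succ (2 * n), Nat.factorial_succ n]
      have := (hG n).ne'
      have : (n : ℝ) + ν + 1 ≠ 0 := by linarith [hn n]
      have : (n : ℝ) + 1 ≠ 0 := by linarith [hn n]
      push_cast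
      rw [pow_succ]
      field_simp
      ring
  have hs : ∀ n : ℕ, (x / 2) ^ (2 * n) = x ^ (2 * n) / 4 ^ n := fun n => by
    rw [div_pow, pow_mul 2 2 n]
    norm_num
  rw [mul_add, mul_add]
  refine HasSum.even_add_odd ?_ ?_
  · refine HasSum.congr_fun
      ((hasSum_rpow_neg_mul_besselI hν hx).mul_left (2 ^ ν * Gamma (ν + 1))) fun n => ?_
    have := (hG n).ne'
    rw [heven, hs]
    field_simp
  · refine HasSum.congr_fun
      ((hasSum_rpow_neg_mul_besselI_add_one hν hx).mul_left (2 ^ ν * Gamma (ν + 1))) fun n => ?_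
    have := (hG n).ne'
    have : (n : ℝ) + ν + 1 ≠ 0 := by linarith [hn n]
    have : 2 * (n : ℝ) + 1 ≠ 0 := by linarith [hn n]
    rw [hodd', heven, hGs, pow_succ (x / 2), hs, Nat.factorial_succ (2 * n), pow_succ x]
    push_cast
    field_simp

lemma Phi_eq_of_hasSum {ν x S : ℝ} (hν : -1 / 2 ≤ ν) {A : ℕ → ℝ} (hx : 0 < x)
    (h0 : A 0 = 1) (h1 : (2 * ν + 2) * A 1 = A 0)
    (hA : ∀ k : ℕ, (2 * ν + 3 + k) * A (k + 2) = A (k + 1) + (k + 1) * A k)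
    (hS : HasSum (fun k : ℕ => A k * (x ^ k / (k ! : ℝ))) S) :
    Phi ν x = exp (-x) * S / (2 ^ ν * Gamma (ν + 1)) := by
  have hG : 0 < Gamma (ν + 1) := Gamma_pos_of_pos (by linarith)
  rw [hS.unique (hasSum_of_moment_recursion hν hx h0 h1 hA), Phi]
  field_simp

/-! ### Integral representation -/

lemma hasSum_betaLaplace {a : ℝ} (ha : 0 < a) (x : ℝ) :
    HasSum (fun k : ℕ => (∫ s, (1 - 2 * s) ^ k ∂(betaMeasure a (a + 1))) * (x ^ k / (k ! : ℝ)))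
      (exp x * betaLaplace a 0 (2 * x)) := by
  have := isProbabilityMeasureBeta ha (by linarith : 0 < a + 1)
  have hi : ∀ k : ℕ, Integrable (fun s : ℝ => (1 - 2 * s) ^ k * (x ^ k / (k ! : ℝ)))
      (betaMeasure a (a + 1)) :=
    fun k => integrable_betaMeasure_of_continuous ha (by linarith) (by fun_prop)
  have key := hasSum_integral_of_summable_integral_norm hi ?_
  · have e : exp x * betaLaplace a 0 (2 * x) = ∫ s, ∑' k : ℕ, (1 - 2 * s) ^ k * (x ^ k / (k ! : ℝ))
        ∂(betaMeasure a (a + 1)) := by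
      rw [betaLaplace, ← integral_const_mul]
      congr 1
      ext s
      have h := (NormedSpace.expSeries_div_hasSum_exp (x * (1 - 2 * s))).tsum_eq
      rw [← Real.exp_eq_exp_ℝ] at h
      rw [pow_zero, one_mul, ← exp_add, show x + 2 * x * -s = x * (1 - 2 * s) by ring, ← h]
      refine tsum_congr fun k => ?_
      rw [mul_pow]
      ring
    rw [e]
    refine HasSum.congr_fun key fun k => ?_
    rw [integral_mul_const]
  · refine Summable.of_nonneg_of_le (fun k => integral_nonneg fun s => norm_nonneg _) (fun k => ?_)
      (Real.summable_pow_div_factorial |x|)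
    calc _ ≤ ∫ s, |x| ^ k / (k ! : ℝ) ∂(betaMeasure a (a + 1)) := by
          refine integral_mono_ae (hi k).norm (integrable_const _) ?_
          filter_upwards [ae_mem_Ioo_betaMeasure a (a + 1)] with s hs
          simp only [norm_mul, norm_pow, norm_div, Real.norm_eq_abs, Nat.abs_cast]
          refine mul_le_of_le_one_left (by positivity) (pow_le_one₀ (abs_nonneg _) ?_)
          rw [abs_le]
          constructor <;> linarith [hs.1, hs.2]
      _ = |x| ^ k / (k ! : ℝ) := by simp

lemma betaMeasure_moment_recursion {a : ℝ} (ha : 0 < a) (k : ℕ) :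
    (2 * a + 2 + k) * ∫ s, (1 - 2 * s) ^ (k + 2) ∂(betaMeasure a (a + 1)) =
      ∫ s, (1 - 2 * s) ^ (k + 1) ∂(betaMeasure a (a + 1)) +
        (k + 1) * ∫ s, (1 - 2 * s) ^ k ∂(betaMeasure a (a + 1)) := by
  have key := betaMeasure_stein ha (u := fun s => (1 - 2 * s) ^ (k + 1))
    (u' := fun s => ((k + 1 : ℕ) : ℝ) * (1 - 2 * s) ^ k * (-2)) (fun s => by
      have := (((hasDerivAt_id s).const_mul 2).const_sub 1).pow (k + 1)
      exact this.congr_deriv (by simp)) (by fun_prop)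
  have hi : ∀ k : ℕ, Integrable (fun s : ℝ => (1 - 2 * s) ^ k) (betaMeasure a (a + 1)) :=
    fun k => integrable_betaMeasure_of_continuous ha (by linarith) (by fun_prop)
  have hr : Integrable (fun s : ℝ => (1 - 2 * s) ^ (k + 1) + (k + 1) * (1 - 2 * s) ^ k)
      (betaMeasure a (a + 1)) := (hi _).add ((hi _).const_mul _)
  rw [← integral_const_mul, ← integral_const_mul, ← integral_add (hi _) ((hi _).const_mul _),
    ← sub_eq_zero, ← integral_sub ((hi _).const_mul _) hr]
  refine Eq.trans ?_ (mul_eq_zero_of_right 2 key)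
  rw [← integral_const_mul]
  congr 1
  ext s
  push_cast
  ring

lemma betaMeasure_moment_one {a : ℝ} (ha : 0 < a) :
    (2 * a + 1) * ∫ s, (1 - 2 * s) ^ 1 ∂(betaMeasure a (a + 1)) =
      ∫ s, (1 - 2 * s) ^ 0 ∂(betaMeasure a (a + 1)) := by
  have key := betaMeasure_stein ha (u := fun _ => 1) (u' := fun _ => 0)
    (fun s => hasDerivAt_const s 1) continuous_const
  have hi : ∀ k : ℕ, Integrable (fun s : ℝ => (1 - 2 * s) ^ k) (betaMeasure a (a + 1)) :=
    fun k => integrable_betaMeasure_of_continuous ha (by linarith) (by fun_prop)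
  rw [← integral_const_mul, ← sub_eq_zero, ← integral_sub ((hi _).const_mul _) (hi _)]
  refine Eq.trans ?_ (mul_eq_zero_of_right 2 key)
  rw [← integral_const_mul]
  congr 1
  ext s
  ring

lemma Phi_eq_betaLaplace {ν : ℝ} (hν : -1 / 2 < ν) {x : ℝ} (hx : 0 < x) :
    Phi ν x = betaLaplace (ν + 1 / 2) 0 (2 * x) / (2 ^ ν * Gamma (ν + 1)) := by
  have ha : 0 < ν + 1 / 2 := by linarith
  have := isProbabilityMeasureBeta ha (by linarith : 0 < ν + 1 / 2 + 1)
  rw [Phi_eq_of_hasSum hν.le hx ?_ ?_ ?_ (hasSum_betaLaplace ha x), ← mul_assoc, ← exp_add]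
  · simp
  · simp only [pow_zero, integral_const, probReal_univ, smul_eq_mul, mul_one]
  · rw [← betaMeasure_moment_one ha]
    ring
  · intro k
    rw [← betaMeasure_moment_recursion ha k]
    ring

lemma Phi_neg_half {x : ℝ} (hx : 0 < x) : Phi (-1 / 2) x = √(2 / π) := by
  have h := NormedSpace.expSeries_div_hasSum_exp x
  rw [← Real.exp_eq_exp_ℝ] at h
  rw [Phi_eq_of_hasSum (A := fun _ => 1) le_rfl hx rfl (by norm_num) (fun k => by ring)
    (by simpa using h), ← exp_add, neg_add_cancel, exp_zero,
    show (-1 / 2 : ℝ) + 1 = 1 / 2 by norm_num, Gamma_one_half_eq,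
    show (-1 / 2 : ℝ) = -(1 / 2) by norm_num, rpow_neg zero_le_two, ← sqrt_eq_rpow,
    sqrt_div zero_le_two]
  field_simp

/-! ### Monotonicity in the order -/

/-- `s ↦ 2 ^ s * Γ s` is logarithmically convex, with positive derivative at `1` because
`γ < 2/3 < log 2`. -/
lemma strictMonoOn_two_rpow_mul_Gamma : StrictMonoOn (fun s : ℝ => 2 ^ s * Gamma s) (Ici 1) := by
  have hlog : ∀ s : ℝ, 0 < s → log (2 ^ s * Gamma s) = log (Gamma s) + s * log 2 := fun s hs => by
    rw [log_mul (by positivity) (Gamma_pos_of_pos hs).ne', log_rpow two_pos, add_comm]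
  have hconv : ConvexOn ℝ (Ioi 0) (fun s : ℝ => log (Gamma s) + s * log 2) :=
    convexOn_log_Gamma.add (((LinearMap.mulRight ℝ (log 2)).convexOn (convex_Ioi 0)))
  have hder : HasDerivAt (fun s : ℝ => log (Gamma s) + s * log 2)
      (-eulerMascheroniConstant / Gamma 1 + 1 * log 2) 1 :=
    (hasDerivAt_Gamma_one.log (by simp)).add ((hasDerivAt_id (1 : ℝ)).mul_const (log 2))
  have hpos : 0 < -eulerMascheroniConstant / Gamma 1 + 1 * log 2 := by
    have := eulerMascheroniConstant_lt_two_thirds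
    have := log_two_gt_d9
    rw [Gamma_one]
    norm_num at *
    linarith
  have hone : ∀ t : ℝ, 1 < t → log (Gamma 1) + 1 * log 2 < log (Gamma t) + t * log 2 := by
    intro t ht
    have := hconv.le_slope_of_hasDerivAt (mem_Ioi.2 one_pos) (mem_Ioi.2 (by linarith)) ht hder
    rw [slope_def_field] at this
    have := (lt_div_iff₀ (by linarith)).1 (hpos.trans_le this)
    linarith
  intro s hs t ht hst
  have hs0 : 0 < s := by linarith [mem_Ici.1 hs]
  have ht0 : 0 < t := by linarith
  have hGs := Gamma_pos_of_pos hs0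
  have hGt := Gamma_pos_of_pos ht0
  refine (log_lt_log_iff (by positivity) (by positivity)).1 ?_
  rw [hlog s hs0, hlog t ht0]
  rcases (mem_Ici.1 hs).eq_or_lt with h | h
  · rw [← h] at hst ⊢
    exact hone t hst
  · have h1 := hconv.slope_mono_adjacent (mem_Ioi.2 one_pos) (mem_Ioi.2 ht0) h hst
    have h2 := div_pos (sub_pos.2 (hone s h)) (sub_pos.2 h)
    have := (lt_div_iff₀ (sub_pos.2 hst)).1 (h2.trans_le h1)
    linarith

/-- The comparison is termwise: the order `ν` enters the coefficients of both Bessel series only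
through `2 ^ ν * Γ(n + ν + 1)` and `2 ^ ν * Γ(n + ν + 2)`. -/
lemma strictAntiOn_Phi {x : ℝ} (hx : 0 < x) : StrictAntiOn (fun ν : ℝ => Phi ν x) (Ici 0) := by
  intro ν hν μ hμ hlt
  have hν0 : 0 ≤ ν := hν
  have hμ0 : 0 ≤ μ := hμ
  have hcoef : ∀ n : ℕ, ∀ c : ℝ, 1 ≤ c →
      0 < 2 ^ ν * Gamma (n + ν + c) ∧ 2 ^ ν * Gamma (n + ν + c) < 2 ^ μ * Gamma (n + μ + c) := by
    intro n c hc
    have hn : (0 : ℝ) ≤ n := n.cast_nonneg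
    have h := strictMonoOn_two_rpow_mul_Gamma (a := n + ν + c) (b := n + μ + c)
      (mem_Ici.2 (by linarith)) (mem_Ici.2 (by linarith)) (by linarith)
    have e : ∀ τ : ℝ, (2 : ℝ) ^ (n + τ + c) = 2 ^ (n + c) * 2 ^ τ := fun τ => by
      rw [← rpow_add two_pos]
      congr 1
      ring
    simp only [e, mul_assoc] at h
    have := Gamma_pos_of_pos (by linarith : 0 < n + ν + c)
    exact ⟨by positivity, lt_of_mul_lt_mul_left h (by positivity)⟩
  have h1 : x ^ (-μ) * besselI μ x < x ^ (-ν) * besselI ν x := by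
    have hlt : ∀ n : ℕ, (x / 2) ^ (2 * n) / ((n ! : ℝ) * (2 ^ μ * Gamma (n + μ + 1)))
        < (x / 2) ^ (2 * n) / ((n ! : ℝ) * (2 ^ ν * Gamma (n + ν + 1))) := fun n => by
      obtain ⟨hp, hl⟩ := hcoef n 1 le_rfl
      gcongr
    exact hasSum_lt (fun n => (hlt n).le) (hlt 0) (hasSum_rpow_neg_mul_besselI (by linarith) hx)
      (hasSum_rpow_neg_mul_besselI (by linarith) hx)
  have h2 : x ^ (-μ) * besselI (μ + 1) x < x ^ (-ν) * besselI (ν + 1) x := by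
    have hlt : ∀ n : ℕ, (x / 2) ^ (2 * n + 1) / ((n ! : ℝ) * (2 ^ μ * Gamma (n + μ + 2)))
        < (x / 2) ^ (2 * n + 1) / ((n ! : ℝ) * (2 ^ ν * Gamma (n + ν + 2))) := fun n => by
      obtain ⟨hp, hl⟩ := hcoef n 2 one_le_two
      gcongr
    exact hasSum_lt (fun n => (hlt n).le) (hlt 0)
      (hasSum_rpow_neg_mul_besselI_add_one (by linarith) hx)
      (hasSum_rpow_neg_mul_besselI_add_one (by linarith) hx)
  simp only [Phi, mul_assoc]
  refine mul_lt_mul_of_pos_left ?_ (exp_pos _)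
  rw [mul_add, mul_add]
  exact add_lt_add h1 h2

/-! ### Complete monotonicity and convexity -/

lemma iteratedDeriv_betaLaplace_comp_two_mul {a : ℝ} (ha : 0 < a) (K : ℝ) (m : ℕ) :
    iteratedDeriv m (fun x => betaLaplace a 0 (2 * x) / K) =
      fun x => 2 ^ m * betaLaplace a m (2 * x) / K := by
  induction m with
  | zero => simp
  | succ m ih =>
    rw [iteratedDeriv_succ, ih]
    ext x
    have h := (hasDerivAt_betaLaplace ha m (2 * x)).comp x ((hasDerivAt_id x).const_mul 2)
    refine ((h.const_mul (2 ^ m)).div_const K).deriv.trans ?_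
    rw [pow_succ]
    ring

lemma isCompletelyMonotonic_Phi {ν : ℝ} (hν : -1 / 2 ≤ ν) : IsCompletelyMonotonic (Phi ν) := by
  rcases hν.eq_or_lt with rfl | hν
  · have hE : EqOn (Phi (-1 / 2)) (fun _ => √(2 / π)) (Ioi 0) := fun x hx => Phi_neg_half hx
    refine ⟨contDiffOn_const.congr hE, fun m x hx => ?_⟩
    rw [iteratedDerivWithin_congr hE hx, iteratedDerivWithin_const]
    split_ifs with h
    · rw [h, pow_zero, one_mul]
      positivity
    · simp
  · have ha : 0 < ν + 1 / 2 := by linarith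
    have hK : 0 < 2 ^ ν * Gamma (ν + 1) :=
      mul_pos (by positivity) (Gamma_pos_of_pos (by linarith))
    have hE : EqOn (Phi ν) (fun x => betaLaplace (ν + 1 / 2) 0 (2 * x) / (2 ^ ν * Gamma (ν + 1)))
      (Ioi 0) := fun x hx => Phi_eq_betaLaplace hν hx
    refine ⟨ContDiffOn.congr (ContDiff.contDiffOn ?_) hE, fun m x hx => ?_⟩
    · exact ((contDiff_betaLaplace ha).comp (contDiff_const.mul contDiff_id)).div_const _
    · rw [iteratedDerivWithin_congr hE hx, iteratedDerivWithin_of_isOpen isOpen_Ioi hx,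
        iteratedDeriv_betaLaplace_comp_two_mul ha, mul_div_assoc', mul_left_comm]
      have := neg_one_pow_mul_betaLaplace_nonneg (ν + 1 / 2) m (2 * x)
      positivity

lemma isLogConvex_Phi {ν : ℝ} (hν : -1 / 2 ≤ ν) : IsLogConvex (Phi ν) := by
  rcases hν.eq_or_lt with rfl | hν
  · have hpos : 0 < √(2 / π) := by positivity
    refine ⟨fun x hx => by rwa [Phi_neg_half hx], fun x y l hx hy hl hl1 => ?_⟩
    have hxy : 0 < l * x + (1 - l) * y := (convex_Ioi (0 : ℝ)) hx hy hl (by linarith) (by ring)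
    rw [Phi_neg_half hx, Phi_neg_half hy, Phi_neg_half hxy, ← rpow_add hpos, add_sub_cancel,
      rpow_one]
  · have ha : 0 < ν + 1 / 2 := by linarith
    have hK : 0 < 2 ^ ν * Gamma (ν + 1) :=
      mul_pos (by positivity) (Gamma_pos_of_pos (by linarith))
    have hf := betaLaplace_zero_pos ha
    refine ⟨fun x hx => ?_, fun x y l hx hy hl hl1 => ?_⟩
    · rw [Phi_eq_betaLaplace hν hx]
      exact div_pos (hf _) hK
    · have hxy : 0 < l * x + (1 - l) * y := (convex_Ioi (0 : ℝ)) hx hy hl (by linarith) (by ring)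
      rw [Phi_eq_betaLaplace hν hx, Phi_eq_betaLaplace hν hy, Phi_eq_betaLaplace hν hxy,
        div_rpow (hf _).le hK.le, div_rpow (hf _).le hK.le, div_mul_div_comm, ← rpow_add hK,
        add_sub_cancel, rpow_one]
      refine div_le_div_of_nonneg_right ?_ hK.le
      have h := (convexOn_log_betaLaplace ha).2 (mem_univ (2 * x)) (mem_univ (2 * y)) hl
        (by linarith : 0 ≤ 1 - l) (by ring)
      simp only [smul_eq_mul] at h
      have hp := mul_pos (rpow_pos_of_pos (hf (2 * x)) l) (rpow_pos_of_pos (hf (2 * y)) (1 - l))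
      rw [← log_le_log_iff (hf _) hp, log_mul (rpow_pos_of_pos (hf _) _).ne'
        (rpow_pos_of_pos (hf _) _).ne', log_rpow (hf _), log_rpow (hf _)]
      rwa [show 2 * (l * x + (1 - l) * y) = l * (2 * x) + (1 - l) * (2 * y) by ring]

lemma isGeometricallyConcave_Phi {ν : ℝ} (hν : -1 / 2 ≤ ν) : IsGeometricallyConcave (Phi ν) := by
  refine ⟨(isLogConvex_Phi hν).1, fun x y l hx hy hl hl1 => ?_⟩
  have hxy : 0 < x ^ l * y ^ (1 - l) := by positivity
  rcases hν.eq_or_lt with rfl | hν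
  · have hpos : 0 < √(2 / π) := by positivity
    rw [Phi_neg_half hx, Phi_neg_half hy, Phi_neg_half hxy, ← rpow_add hpos, add_sub_cancel,
      rpow_one]
  · have ha : 0 < ν + 1 / 2 := by linarith
    have hK : 0 < 2 ^ ν * Gamma (ν + 1) :=
      mul_pos (by positivity) (Gamma_pos_of_pos (by linarith))
    have hf := betaLaplace_zero_pos ha
    rw [Phi_eq_betaLaplace hν hx, Phi_eq_betaLaplace hν hy, Phi_eq_betaLaplace hν hxy,
      div_rpow (hf _).le hK.le, div_rpow (hf _).le hK.le, div_mul_div_comm, ← rpow_add hK,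
      add_sub_cancel, rpow_one]
    refine div_le_div_of_nonneg_right ?_ hK.le
    have h := (concaveOn_log_betaLaplace_exp ha).2 (mem_univ (log (2 * x)))
      (mem_univ (log (2 * y))) hl (by linarith : 0 ≤ 1 - l) (by ring)
    have e : exp (l * log (2 * x) + (1 - l) * log (2 * y)) = 2 * (x ^ l * y ^ (1 - l)) := by
      rw [exp_add, mul_comm l, mul_comm (1 - l), ← rpow_def_of_pos (by positivity),
        ← rpow_def_of_pos (by positivity), mul_rpow zero_le_two hx.le, mul_rpow zero_le_two hy.le,
        mul_mul_mul_comm, ← rpow_add two_pos, add_sub_cancel, rpow_one]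
    simp only [smul_eq_mul] at h
    rw [exp_log (by positivity), exp_log (by positivity), e] at h
    have hp := mul_pos (rpow_pos_of_pos (hf (2 * x)) l) (rpow_pos_of_pos (hf (2 * y)) (1 - l))
    rw [← log_le_log_iff hp (hf _), log_mul (rpow_pos_of_pos (hf _) _).ne'
      (rpow_pos_of_pos (hf _) _).ne', log_rpow (hf _), log_rpow (hf _)]
    exact h

/-! ### Multiplication by powers, and bounds -/

lemma rpow_mul_Phi_eq {ν : ℝ} (hν : -1 / 2 < ν) {x : ℝ} (hx : 0 < x) :
    (x + ν / 2 + 1 / 4) ^ (ν + 1 / 2) * Phi ν x =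
      (2 * x + (ν + 1 / 2)) ^ (ν + 1 / 2) * betaLaplace (ν + 1 / 2) 0 (2 * x) /
        (2 ^ (ν + 1 / 2) * (2 ^ ν * Gamma (ν + 1))) := by
  rw [Phi_eq_betaLaplace hν hx,
    show x + ν / 2 + 1 / 4 = (2 * x + (ν + 1 / 2)) / 2 by ring,
    div_rpow (by linarith) zero_le_two, div_mul_div_comm]

/-- For every shift `c ≤ ν / 2 + 1 / 4`, the function `(x + c) ^ (ν + 1 / 2) * Φ_ν x` is the one
with the largest shift times a power of the nondecreasing ratio `(x + c) / (x + ν / 2 + 1 / 4)`. -/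
lemma rpow_add_mul_Phi_lt {ν c : ℝ} (hν : -1 / 2 < ν) (hc : c ≤ ν / 2 + 1 / 4) {x y : ℝ}
    (hx : 0 < x) (hxc : 0 ≤ x + c) (hxy : x < y) :
    (x + c) ^ (ν + 1 / 2) * Phi ν x < (y + c) ^ (ν + 1 / 2) * Phi ν y := by
  have ha : 0 < ν + 1 / 2 := by linarith
  have hy : 0 < y := hx.trans hxy
  have hK : 0 < 2 ^ ν * Gamma (ν + 1) :=
    mul_pos (by positivity) (Gamma_pos_of_pos (by linarith))
  have hH : (x + ν / 2 + 1 / 4) ^ (ν + 1 / 2) * Phi ν x <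
      (y + ν / 2 + 1 / 4) ^ (ν + 1 / 2) * Phi ν y := by
    rw [rpow_mul_Phi_eq hν hx, rpow_mul_Phi_eq hν hy]
    refine div_lt_div_of_pos_right ?_ (by positivity)
    exact strictMonoOn_rpow_mul_betaLaplace ha (mem_Ici.2 (by linarith))
      (mem_Ici.2 (by linarith)) (by linarith)
  have hsplit : ∀ z : ℝ, 0 < z → 0 ≤ z + c → (z + c) ^ (ν + 1 / 2) * Phi ν z =
      ((z + c) / (z + ν / 2 + 1 / 4)) ^ (ν + 1 / 2) *
        ((z + ν / 2 + 1 / 4) ^ (ν + 1 / 2) * Phi ν z) := by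
    intro z hz hzc
    have hz0 : 0 < z + ν / 2 + 1 / 4 := by linarith
    rw [div_rpow hzc hz0.le, ← mul_assoc, div_mul_cancel₀ _ (rpow_pos_of_pos hz0 _).ne']
  have hx0 : 0 < x + ν / 2 + 1 / 4 := by linarith
  have hy0 : 0 < y + ν / 2 + 1 / 4 := by linarith
  rw [hsplit x hx hxc, hsplit y hy (by linarith)]
  refine mul_lt_mul' ?_ hH ?_ ?_
  · refine rpow_le_rpow (by positivity) ?_ ha.le
    rw [div_le_div_iff₀ hx0 hy0]
    nlinarith
  · exact (mul_pos (rpow_pos_of_pos hx0 _) ((isLogConvex_Phi hν.le).1 x hx)).le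
  · exact rpow_pos_of_pos (div_pos (by linarith) hy0) _

lemma strictMonoOn_rpow_add_mul_Phi {ν c : ℝ} (hν : -1 / 2 < ν) (hc : c ≤ ν / 2 + 1 / 4)
    {D : Set ℝ} (hD : ∀ x ∈ D, 0 < x ∧ 0 ≤ x + c) :
    StrictMonoOn (fun x : ℝ => (x + c) ^ (ν + 1 / 2) * Phi ν x) D :=
  fun x hx _ _ hxy => rpow_add_mul_Phi_lt hν hc (hD x hx).1 (hD x hx).2 hxy

lemma monotoneOn_and_strictMonoOn_rpow_add_mul_Phi {ν c : ℝ} (hν : -1 / 2 ≤ ν)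
    (hc : c ≤ ν / 2 + 1 / 4) {D : Set ℝ} (hD : ∀ x ∈ D, 0 < x ∧ (0 ≤ x + c ∨ ν = -1 / 2)) :
    MonotoneOn (fun x : ℝ => (x + c) ^ (ν + 1 / 2) * Phi ν x) D ∧
      (-1 / 2 < ν → StrictMonoOn (fun x : ℝ => (x + c) ^ (ν + 1 / 2) * Phi ν x) D) := by
  have hs : -1 / 2 < ν → StrictMonoOn (fun x : ℝ => (x + c) ^ (ν + 1 / 2) * Phi ν x) D :=
    fun h => strictMonoOn_rpow_add_mul_Phi h hc fun x hx =>
      ⟨(hD x hx).1, (hD x hx).2.resolve_right h.ne'⟩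
  refine ⟨?_, hs⟩
  rcases hν.eq_or_lt with rfl | h
  · intro x hx y hy _
    simp only [Phi_neg_half (hD x hx).1, Phi_neg_half (hD y hy).1]
    norm_num
  · exact (hs h).monotoneOn

lemma lt_Phi {ν x : ℝ} (hν : -1 / 2 < ν) (hx : 0 < x) :
    (ν + 1 / 2) ^ (ν + 1 / 2) /
        ((2 : ℝ) ^ (2 * ν + 1 / 2) * Gamma (ν + 1) * (x + ν / 2 + 1 / 4) ^ (ν + 1 / 2))
      < Phi ν x := by
  have ha : 0 < ν + 1 / 2 := by linarith
  have hG : 0 < Gamma (ν + 1) := Gamma_pos_of_pos (by linarith)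
  have hx0 : 0 < x + ν / 2 + 1 / 4 := by linarith
  have h := strictMonoOn_rpow_mul_betaLaplace ha (mem_Ici.2 le_rfl)
    (mem_Ici.2 (by linarith : 0 ≤ 2 * x)) (by linarith)
  simp only [betaLaplace_zero_zero ha, zero_add, mul_one] at h
  rw [← div_div, div_lt_iff₀ (rpow_pos_of_pos hx0 _), mul_comm (Phi ν x), rpow_mul_Phi_eq hν hx,
    ← mul_assoc, ← rpow_add two_pos, show ν + 1 / 2 + ν = 2 * ν + 1 / 2 by ring]
  exact div_lt_div_of_pos_right h (by positivity)

lemma Phi_lt {ν x : ℝ} (hν : -1 / 2 < ν) (hx : 0 < x) :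
    Phi ν x < √(2 / π) * (1 / (x + ν / 2 + 1 / 4) ^ (ν + 1 / 2)) := by
  have ha : 0 < ν + 1 / 2 := by linarith
  have hG : 0 < Gamma (ν + 1) := Gamma_pos_of_pos (by linarith)
  have hx0 : 0 < x + ν / 2 + 1 / 4 := by linarith
  have h := rpow_mul_betaLaplace_lt ha (by linarith : 0 < 2 * x)
  rw [mul_one_div, lt_div_iff₀ (rpow_pos_of_pos hx0 _), mul_comm (Phi ν x),
    rpow_mul_Phi_eq hν hx, div_lt_iff₀ (by positivity)]
  refine h.trans_eq ?_
  have hdup := Gamma_mul_Gamma_add_half (ν + 1)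
  rw [show 1 - 2 * (ν + 1) = -(ν + 1 / 2 + (ν + 1 / 2)) by ring, rpow_neg zero_le_two,
    rpow_add two_pos, show ν + 1 + 1 / 2 = ν + 1 / 2 + 1 by ring] at hdup
  have h2 : (2 : ℝ) ^ ν * √2 = 2 ^ (ν + 1 / 2) := by rw [rpow_add two_pos, sqrt_eq_rpow]
  have hGa := Gamma_pos_of_pos ha
  have hGa1 := Gamma_pos_of_pos (by linarith : 0 < ν + 1 / 2 + 1)
  have hp : (0 : ℝ) < 2 ^ (ν + 1 / 2) := by positivity
  rw [beta, show ν + 1 / 2 + (ν + 1 / 2 + 1) = 2 * (ν + 1) by ring, sqrt_div zero_le_two]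
  have e : √2 / √π * (2 ^ (ν + 1 / 2) * (2 ^ ν * Gamma (ν + 1)))
      = 2 ^ (ν + 1 / 2) * 2 ^ (ν + 1 / 2) * Gamma (ν + 1) / √π := by
    rw [← h2]
    ring
  rw [e]
  generalize Gamma (ν + 1 / 2) = A at *
  generalize Gamma (ν + 1 / 2 + 1) = B at *
  generalize (2 : ℝ) ^ (ν + 1 / 2) = q at *
  field_simp at hdup ⊢
  linarith

end

theorem theorem1 :
    -- a
    (∀ ν : ℝ, -1 / 2 ≤ ν → IsCompletelyMonotonic (Phi ν)) ∧
    -- b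
    (∀ ν : ℝ, -1 / 2 ≤ ν → IsLogConvex (Phi ν) ∧ IsGeometricallyConcave (Phi ν)) ∧
    -- c
    (∀ x : ℝ, 0 < x → StrictAntiOn (fun ν : ℝ => Phi ν x) (Ici 0)) ∧
    -- d
    (∀ ν : ℝ, -1 / 2 ≤ ν →
      MonotoneOn (fun x : ℝ => x ^ (ν + 1 / 2) * Phi ν x) (Ioi 0) ∧
      (-1 / 2 < ν → StrictMonoOn (fun x : ℝ => x ^ (ν + 1 / 2) * Phi ν x) (Ioi 0))) ∧
    -- e
    (∀ ν : ℝ, -1 / 2 ≤ ν →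
      MonotoneOn (fun x : ℝ => (x + ν / 2) ^ (ν + 1 / 2) * Phi ν x) (powDomain ν) ∧
      (-1 / 2 < ν →
        StrictMonoOn (fun x : ℝ => (x + ν / 2) ^ (ν + 1 / 2) * Phi ν x) (powDomain ν))) ∧
    -- f
    (∀ ν : ℝ, -1 / 2 ≤ ν →
      MonotoneOn (fun x : ℝ => (x + ν / 2 + 1 / 4) ^ (ν + 1 / 2) * Phi ν x) (Ioi 0) ∧
      (-1 / 2 < ν →
        StrictMonoOn (fun x : ℝ => (x + ν / 2 + 1 / 4) ^ (ν + 1 / 2) * Phi ν x) (Ioi 0))) ∧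
    -- g
    (∀ ν x : ℝ, -1 / 2 < ν → 0 < x →
      (ν + 1 / 2) ^ (ν + 1 / 2) /
          ((2 : ℝ) ^ (2 * ν + 1 / 2) * Real.Gamma (ν + 1) * (x + ν / 2 + 1 / 4) ^ (ν + 1 / 2))
        < Phi ν x ∧
      Phi ν x < √(2 / π) * (1 / (x + ν / 2 + 1 / 4) ^ (ν + 1 / 2))) := by
  refine ⟨fun ν => isCompletelyMonotonic_Phi,
    fun ν hν => ⟨isLogConvex_Phi hν, isGeometricallyConcave_Phi hν⟩,
    fun x hx => strictAntiOn_Phi hx, fun ν hν => ?_, fun ν hν => ?_, fun ν hν => ?_,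
    fun ν x hν hx => ⟨lt_Phi hν hx, Phi_lt hν hx⟩⟩
  · have := monotoneOn_and_strictMonoOn_rpow_add_mul_Phi (c := 0) (D := Ioi 0) hν (by linarith)
      fun x hx => ⟨hx, Or.inl (by linarith [mem_Ioi.1 hx])⟩
    simpa only [add_zero] using this
  · exact monotoneOn_and_strictMonoOn_rpow_add_mul_Phi hν (by linarith) fun x hx => hx
  · have := monotoneOn_and_strictMonoOn_rpow_add_mul_Phi (D := Ioi 0) hν le_rfl
      fun x hx => ⟨hx, Or.inl (by linarith [mem_Ioi.1 hx])⟩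
    simpa only [← add_assoc] using this
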